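/- Let $G$ be a finite simple graph that is \emph{nice}, i.e. no connected component of $G$ is isomorphic to $K_2$. Then there is a mapping $\omega : E(G)\to\{1,\dots,7\}$ (a $7$-edge-weighting) such that (a) $\omega$ is neighbour sum distinguishing: writing $\sigma_\omega(v)=\sum_{u\in N_G(v)}\omega(vu)$ for every vertex $v$, one has $\sigma_\omega(u)\neq\sigma_\omega(v)$ for every edge $uv$ of $G$; and (b) every vertex of degree at least $6$ in $G$ is incident with at least two edges of different weights. -/

import Mathlib

/-- A graph is nice if none of its connected components is isomorphic to `K₂`. -/
def SimpleGraph.IsNice {V : Type*} (G : SimpleGraph V) : Prop :=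
  ∀ C : G.ConnectedComponent, IsEmpty (C.toSimpleGraph ≃g SimpleGraph.completeGraph (Fin 2))

/-- `ω` is a `k`-edge-weighting of `G`: all its values lie in `{1, …, k}`. -/
def SimpleGraph.IsEdgeWeighting {V : Type*} (G : SimpleGraph V) (k : ℕ)
    (ω : G.edgeSet → ℕ) : Prop :=
  ∀ e, ω e ∈ Finset.Icc 1 k

/-- The vertex-colouring induced by `ω`: `σ_ω(v) = ∑_{u ∈ N(v)} ω(vu)`. -/
def SimpleGraph.weightSum {V : Type*} (G : SimpleGraph V) (ω : G.edgeSet → ℕ) (v : V)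
    [Fintype (G.neighborSet v)] : ℕ :=
  ∑ u : G.neighborSet v, ω ⟨s(v, (u : V)), u.2⟩

/-- `ω` is neighbour sum distinguishing: the induced vertex-colouring is proper. -/
def SimpleGraph.IsNeighbourSumDistinguishing {V : Type*} (G : SimpleGraph V)
    [G.LocallyFinite] (ω : G.edgeSet → ℕ) : Prop :=
  ∀ ⦃u v : V⦄, G.Adj u v → G.weightSum ω u ≠ G.weightSum ω v

open Finset

/-! Fix in each component a root of degree other than one; it exists because a component with all
degrees one is `K₂`. Process the non-roots by decreasing distance to their root, so that each still
has an unprocessed neighbour at its turn. A processed vertex `v` reserves the sums `w v` and `w v +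
2`, with `w v` congruent to 0 or 1 mod 4. Pairs with different `w` are then disjoint, so adjacent
non-roots only need different `w`.

At its turn, `v` may raise by 2 any back edge from its base `x u`, the weight that puts the
processed neighbour `u` at `w u`. Raising `j` back edges and tuning one forward edge reaches enough
sums for some allowed one to avoid `w` on all processed neighbours. Bases lie in 1..5, whence the
bound 7. Two different weights at `v` survive if they differ in parity, since later changes are by
2, or if both edges join processed vertices, since such edges are final.

A root has no forward edge, so only the number and choice of raised edges remain. Counting conflicts
gives a valid choice unless the degree is one, and enough choices for (b) when it is at least six.
-/

/-- The map `i ↦ 2 * i - i % 2` enumerates the integers congruent to 0 or 1 mod 4 in increasing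
order. -/
theorem exists_good_notMem (F : Finset ℤ) (n : ℕ) (hF : F.card ≤ n) (i₀ : ℤ) :
    ∃ i, i₀ ≤ i ∧ i ≤ i₀ + n ∧ 2 * i - i % 2 ∉ F := by
  by_contra! h
  have hsub : (Icc i₀ (i₀ + n)).image (fun i => 2 * i - i % 2) ⊆ F := by
    intro z hz
    obtain ⟨i, hi, rfl⟩ := mem_image.1 hz
    exact h i (mem_Icc.1 hi).1 (mem_Icc.1 hi).2
  have hcard := card_le_card hsub
  rw [card_image_of_injective _ (fun a b (hab : 2 * a - a % 2 = 2 * b - b % 2) => by omega), Int.card_Icc] at hcard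
  omega

/-! ### Choosing the weights at a single vertex -/

section Selection

variable {V : Type*} [DecidableEq V]

/-- The values `x` on `N`, raised by `2` on `R`, and the values `y` elsewhere. -/
def raise (N R : Finset V) (x y : V → ℤ) (u : V) : ℤ :=
  if u ∈ N then x u + (if u ∈ R then 2 else 0) else y u

theorem raise_eq_or {N R : Finset V} {x y : V → ℤ} {u : V} (hu : u ∈ N) :
    raise N R x y u = x u ∨ raise N R x y u = x u + 2 := by
  unfold raise
  rw [if_pos hu]
  split_ifs <;> simp

theorem raise_of_notMem {N R : Finset V} {x y : V → ℤ} {u : V} (hu : u ∉ N) :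
    raise N R x y u = y u := if_neg hu

theorem raise_of_mem {N R : Finset V} {x y : V → ℤ} {u : V} (hu : u ∈ N) :
    raise N R x y u = x u + (if u ∈ R then 2 else 0) := if_pos hu

theorem sum_raise {N R : Finset V} (hR : R ⊆ N) (x y : V → ℤ) :
    ∑ u ∈ N, raise N R x y u = ∑ u ∈ N, x u + 2 * R.card := by
  rw [sum_congr rfl fun u hu => raise_of_mem hu, sum_add_distrib, sum_ite_mem,
    inter_eq_right.2 hR, sum_const, nsmul_eq_mul, mul_comm]

theorem sum_union_raise {N R E : Finset V} (hR : R ⊆ N) (hNE : Disjoint N E) (x y : V → ℤ) :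
    ∑ u ∈ N ∪ E, raise N R x y u = ∑ u ∈ N, x u + 2 * R.card + ∑ u ∈ E, y u := by
  rw [sum_union hNE, sum_raise hR]
  congr 1
  exact sum_congr rfl fun u hu => raise_of_notMem (disjoint_right.1 hNE hu)

/-- The requirements on the new weights `f` of the edges at a vertex with processed neighbours `N`
and unprocessed neighbours `E`. -/
structure IsUpdate (N E : Finset V) (x w f : V → ℤ) : Prop where
  back : ∀ u ∈ N, f u = x u ∨ f u = x u + 2
  forward : ∀ u ∈ E, 1 ≤ f u ∧ f u ≤ 5
  forward_strong : ∀ u ∈ E, ∀ u' ∈ E, u ≠ u' → 3 ≤ f u ∧ f u ≤ 5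
  sum_mod : (∑ u ∈ N ∪ E, f u) % 4 = 0 ∨ (∑ u ∈ N ∪ E, f u) % 4 = 1
  sum_ne : ∀ u ∈ N, w u ≠ ∑ u ∈ N ∪ E, f u
  not_mono : 6 ≤ (N ∪ E).card → ∃ u ∈ N ∪ E, ∃ u' ∈ N ∪ E,
    f u ≠ f u' ∧ (f u % 2 ≠ f u' % 2 ∨ (u ∈ N ∧ u' ∈ N))

/-- The edge to `t` tunes the sum, the edge to `g` breaks monochromaticity, and the other forward
edges get 4. -/
theorem exists_isUpdate_of_two {N E : Finset V} (hNE : Disjoint N E) (x w : V → ℤ)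
    {t g : V} (ht : t ∈ E) (hg : g ∈ E) (htg : t ≠ g) : ∃ f, IsUpdate N E x w f := by
  -- Opposite parity to some back edge if there is one; otherwise 3, against the 4 on a third
  -- forward edge.
  obtain ⟨q, hq, hqN⟩ : ∃ q : ℤ, (q = 3 ∨ q = 4) ∧
      (N.Nonempty ∨ q ≠ 4) ∧ (N.Nonempty → ∃ u ∈ N, x u % 2 ≠ q % 2) := by
    rcases N.eq_empty_or_nonempty with rfl | ⟨u, hu⟩
    · exact ⟨3, by simp, by simp, by simp⟩
    · rcases Int.emod_two_eq_zero_or_one (x u) with h | h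
      · exact ⟨3, by simp, .inl ⟨u, hu⟩, fun _ => ⟨u, hu, by omega⟩⟩
      · exact ⟨4, by simp, .inl ⟨u, hu⟩, fun _ => ⟨u, hu, by omega⟩⟩
  let y : ℤ → V → ℤ := fun T u => if u = t then T else if u = g then q else 4
  let A := ∑ u ∈ N, x u + ∑ u ∈ E.erase t, y 0 u
  have hsum : ∀ R ⊆ N, ∀ T, ∑ u ∈ N ∪ E, raise N R x (y T) u = A + 2 * R.card + T := by
    intro R hR T
    rw [sum_union_raise hR hNE, ← sum_erase_add _ _ ht]
    have : ∑ u ∈ E.erase t, y T u = ∑ u ∈ E.erase t, y 0 u :=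
      sum_congr rfl fun u hu => by simp [y, ne_of_mem_erase hu]
    rw [this]
    simp only [A, y, if_true]
    ring
  -- The starting index is that of the least allowed sum from `A + 3` on; the same formula recurs
  -- below with other offsets.
  obtain ⟨i, hi1, hi2, hiF⟩ := exists_good_notMem (N.image w) N.card card_image_le
    (if (A + 3) % 4 = 0 then (A + 3) / 2 else if (A + 3) % 4 = 1 then (A + 4) / 2
      else 2 * ((A + 3) / 4) + 2)
  obtain ⟨j, T, hj, hT, hjT⟩ : ∃ (j : ℕ) (T : ℤ), j ≤ N.card ∧ (3 ≤ T ∧ T ≤ 5) ∧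
      2 * i - i % 2 = A + 2 * j + T := by
    have h1 : 3 ≤ 2 * i - i % 2 - A ∧ 2 * i - i % 2 - A ≤ 2 * N.card + 5 := by
      split_ifs at hi1 hi2 <;> omega
    by_cases h2 : 2 * i - i % 2 - A ≤ 2 * N.card + 3
    · refine ⟨((2 * i - i % 2 - A - 3) / 2).toNat,
        2 * i - i % 2 - A - 2 * ((2 * i - i % 2 - A - 3) / 2), ?_, ?_, ?_⟩ <;> omega
    · exact ⟨N.card, 2 * i - i % 2 - A - 2 * N.card, by omega, by omega, by omega⟩
  obtain ⟨R, hR, hRj⟩ := exists_subset_card_eq hj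
  have hS : ∑ u ∈ N ∪ E, raise N R x (y T) u = 2 * i - i % 2 := by
    rw [hsum R hR, hRj, hjT]
  have hE : ∀ u ∈ E, raise N R x (y T) u = y T u :=
    fun u hu => raise_of_notMem (disjoint_right.1 hNE hu)
  have hE' : ∀ u ∈ E, 3 ≤ raise N R x (y T) u ∧ raise N R x (y T) u ≤ 5 := by
    intro u hu
    rw [hE u hu]
    simp only [y]
    split_ifs <;> omega
  have hgv : raise N R x (y T) g = q := by rw [hE g hg]; simp [y, htg.symm]
  refine ⟨raise N R x (y T), fun u hu => raise_eq_or hu, fun u hu => ?_,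
    fun u hu _ _ _ => hE' u hu, by rw [hS]; omega, fun u hu h => ?_, fun h6 => ?_⟩
  · have := hE' u hu
    omega
  · exact hiF (mem_image.2 ⟨u, hu, by rw [h, hS]⟩)
  · rcases N.eq_empty_or_nonempty with rfl | hN
    · have h4 : q ≠ 4 := by simpa using hqN.1
      rw [empty_union] at h6
      obtain ⟨k, hk⟩ : ((E.erase t).erase g).Nonempty := by
        rw [← card_pos, card_erase_of_mem (mem_erase.2 ⟨htg.symm, hg⟩), card_erase_of_mem ht]
        omega
      simp only [mem_erase] at hk
      have hkv : raise ∅ R x (y T) k = 4 := by rw [hE k hk.2.2]; simp [y, hk]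
      refine ⟨g, mem_union_right _ hg, k, mem_union_right _ hk.2.2, ?_, .inl ?_⟩ <;>
        rw [hgv, hkv] <;> omega
    · obtain ⟨u, hu, huq⟩ := hqN.2 hN
      have := raise_eq_or (R := R) (x := x) (y := y T) hu
      refine ⟨g, mem_union_right _ hg, u, mem_union_left _ hu, ?_, .inl ?_⟩ <;>
        rw [hgv] <;> omega

/-- `T` together with `x` raised on `R` is robustly not constant. -/
def Robust (N R : Finset V) (x : V → ℤ) (T : ℤ) : Prop :=
  (∃ u ∈ N, x u % 2 ≠ T % 2) ∨
    ∃ u ∈ N, ∃ u' ∈ N, x u + (if u ∈ R then 2 else 0) ≠ x u' + (if u' ∈ R then 2 else 0)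

/-- If all `x u` have the parity of `s`, a proper nonempty `R` is needed: leaving `a` and raising
`b` with `x a ≤ x b` separates the two. This excludes the extreme values of `s`. -/
theorem exists_robust {N : Finset V} (x : V → ℤ) (hN : 2 ≤ N.card) {s : ℤ}
    (hs : 1 ≤ s) (hs' : s ≤ 2 * N.card + 5)
    (h : (3 ≤ s ∧ s ≤ 2 * N.card + 3) ∨ ∃ u ∈ N, x u % 2 ≠ s % 2) :
    ∃ R ⊆ N, ∃ T, 1 ≤ T ∧ T ≤ 5 ∧ 2 * (R.card : ℤ) + T = s ∧ Robust N R x T := by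
  by_cases hp : ∃ u ∈ N, x u % 2 ≠ s % 2
  · obtain ⟨u, hu, hus⟩ := hp
    obtain ⟨j, hj, hj1, hj2⟩ : ∃ j : ℕ, j ≤ N.card ∧ 1 ≤ s - 2 * j ∧ s - 2 * j ≤ 5 := by
      by_cases hsN : s ≤ 2 * N.card + 1
      · exact ⟨((s - 1) / 2).toNat, by omega, by omega, by omega⟩
      · exact ⟨N.card, le_rfl, by omega, by omega⟩
    obtain ⟨R, hR, rfl⟩ := exists_subset_card_eq hj
    exact ⟨R, hR, s - 2 * R.card, hj1, hj2, by ring, .inl ⟨u, hu, by omega⟩⟩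
  · obtain ⟨hs3, hs4⟩ := h.resolve_right hp
    obtain ⟨j, hj0, hj, hj1, hj2⟩ : ∃ j : ℕ, 1 ≤ j ∧ j ≤ N.card - 1 ∧
        1 ≤ s - 2 * j ∧ s - 2 * j ≤ 5 := by
      by_cases hsN : s ≤ 2 * N.card
      · exact ⟨((s - 1) / 2).toNat, by omega, by omega, by omega, by omega⟩
      · exact ⟨N.card - 1, by omega, le_rfl, by omega, by omega⟩
    obtain ⟨a, b, ha, hb, hab, hxab⟩ : ∃ a b, a ∈ N ∧ b ∈ N ∧ a ≠ b ∧ x a ≤ x b := by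
      obtain ⟨a, ha, b, hb, hab⟩ := one_lt_card.1 (show 1 < N.card by omega)
      rcases le_total (x a) (x b) with hx | hx
      · exact ⟨a, b, ha, hb, hab, hx⟩
      · exact ⟨b, a, hb, ha, hab.symm, hx⟩
    obtain ⟨R, hbR, hRa, rfl⟩ := exists_subsuperset_card_eq
      (show {b} ⊆ N.erase a by simp [hb, hab.symm]) (n := j) (by simpa using hj0)
      (by rw [card_erase_of_mem ha]; exact hj)
    have hbR' : b ∈ R := hbR (mem_singleton_self b)
    have haR : a ∉ R := fun h => notMem_erase a N (hRa h)
    refine ⟨R, hRa.trans (erase_subset _ _), s - 2 * R.card, hj1, hj2, by ring,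
      .inr ⟨a, ha, b, hb, ?_⟩⟩
    rw [if_neg haR, if_pos hbR']
    omega

theorem exists_isUpdate_of_one {N : Finset V} {t : V} (ht : t ∉ N) (x w : V → ℤ) :
    ∃ f, IsUpdate N {t} x w f := by
  have hNE : Disjoint N {t} := disjoint_singleton_right.2 ht
  set A := ∑ u ∈ N, x u with hA
  suffices h : ∃ R ⊆ N, ∃ T, 1 ≤ T ∧ T ≤ 5 ∧
      ((A + 2 * R.card + T) % 4 = 0 ∨ (A + 2 * R.card + T) % 4 = 1) ∧
      A + 2 * R.card + T ∉ N.image w ∧ (5 ≤ N.card → Robust N R x T) by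
    obtain ⟨R, hR, T, hT1, hT5, hmod, hw, hrob⟩ := h
    have hS : ∑ u ∈ N ∪ {t}, raise N R x (fun _ => T) u = A + 2 * R.card + T := by
      rw [sum_union_raise hR hNE, sum_singleton]
    have htv : raise N R x (fun _ => T) t = T := raise_of_notMem ht
    refine ⟨raise N R x fun _ => T, fun u hu => raise_eq_or hu, fun u hu => ?_,
      fun u hu u' hu' h => ?_, by rwa [hS], fun u hu h => ?_, fun h6 => ?_⟩
    · rw [mem_singleton.1 hu, htv]
      exact ⟨hT1, hT5⟩
    · exact absurd ((mem_singleton.1 hu).trans (mem_singleton.1 hu').symm) h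
    · exact hw (mem_image.2 ⟨u, hu, by rw [h, hS]⟩)
    · rw [card_union_of_disjoint hNE, card_singleton] at h6
      rcases hrob (by omega) with ⟨u, hu, hu'⟩ | ⟨u, hu, u', hu', h⟩
      · have := raise_eq_or (R := R) (x := x) (y := fun _ => T) hu
        refine ⟨u, mem_union_left _ hu, t, by simp, ?_, .inl ?_⟩ <;> rw [htv] <;> omega
      · exact ⟨u, mem_union_left _ hu, u', mem_union_left _ hu',
          by rwa [raise_of_mem hu, raise_of_mem hu'], .inr ⟨hu, hu'⟩⟩
  by_cases h5 : 5 ≤ N.card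
  · suffices h : ∃ i : ℤ, 1 ≤ 2 * i - i % 2 - A ∧ 2 * i - i % 2 - A ≤ 2 * N.card + 5 ∧
        2 * i - i % 2 ∉ N.image w ∧
        ((3 ≤ 2 * i - i % 2 - A ∧ 2 * i - i % 2 - A ≤ 2 * N.card + 3) ∨
          ∃ u ∈ N, x u % 2 ≠ (2 * i - i % 2 - A) % 2) by
      obtain ⟨i, h1, h2, h3, h4⟩ := h
      obtain ⟨R, hR, T, hT1, hT5, hs, hrob⟩ := exists_robust x (by omega) h1 h2 h4
      have hs' : A + 2 * R.card + T = 2 * i - i % 2 := by omega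
      exact ⟨R, hR, T, hT1, hT5, by rw [hs']; omega, by rwa [hs'], fun _ => hrob⟩
    by_cases hodd : ∃ u ∈ N, x u % 2 ≠ 0
    · obtain ⟨i, hi1, hi2, hiF⟩ := exists_good_notMem (N.image w) N.card card_image_le
        (if (A + 2) % 4 = 0 then (A + 2) / 2 else if (A + 2) % 4 = 1 then (A + 3) / 2
          else 2 * ((A + 2) / 4) + 2)
      have h1 : 2 ≤ 2 * i - i % 2 - A ∧ 2 * i - i % 2 - A ≤ 2 * N.card + 4 := by
        split_ifs at hi1 hi2 <;> omega
      refine ⟨i, by omega, by omega, hiF, ?_⟩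
      by_cases h2 : 3 ≤ 2 * i - i % 2 - A ∧ 2 * i - i % 2 - A ≤ 2 * N.card + 3
      · exact .inl h2
      · obtain ⟨u, hu, hu'⟩ := hodd
        exact .inr ⟨u, hu, by omega⟩
    · push Not at hodd
      obtain ⟨i, hi1, hi2, hi3, hi4, hiF⟩ : ∃ i : ℤ, 1 ≤ 2 * i - i % 2 - A ∧
          2 * i - i % 2 - A ≤ 2 * N.card + 5 ∧ 2 * i - i % 2 - A ≠ 2 ∧
          2 * i - i % 2 - A ≠ 2 * N.card + 4 ∧ 2 * i - i % 2 ∉ N.image w := by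
        by_cases hl : (A + 2) % 4 = 0 ∨ (A + 2) % 4 = 1
        · by_cases hr : (A + 2 * N.card + 4) % 4 = 0 ∨ (A + 2 * N.card + 4) % 4 = 1
          · obtain ⟨i, hi1, hi2, hiF⟩ := exists_good_notMem
              (insert (A + 2) (insert (A + 2 * N.card + 4) (N.image w))) (N.card + 2)
              ((card_insert_le _ _).trans (Nat.succ_le_succ
                ((card_insert_le _ _).trans (Nat.succ_le_succ card_image_le))))
              (2 * ((A + 2) / 4))
            simp only [mem_insert, not_or] at hiF
            exact ⟨i, by omega, by omega, by omega, by omega, hiF.2.2⟩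
          · obtain ⟨i, hi1, hi2, hiF⟩ := exists_good_notMem (N.image w) N.card card_image_le
              (if (A + 3) % 4 = 0 then (A + 3) / 2 else if (A + 3) % 4 = 1 then (A + 4) / 2
                else 2 * ((A + 3) / 4) + 2)
            split_ifs at hi1 hi2 <;>
              exact ⟨i, by omega, by omega, by omega, by omega, hiF⟩
        · obtain ⟨i, hi1, hi2, hiF⟩ := exists_good_notMem (N.image w) N.card card_image_le
            (if (A + 1) % 4 = 0 then (A + 1) / 2 else if (A + 1) % 4 = 1 then (A + 2) / 2
              else 2 * ((A + 1) / 4) + 2)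
          split_ifs at hi1 hi2 <;>
            exact ⟨i, by omega, by omega, by omega, by omega, hiF⟩
      refine ⟨i, hi1, hi2, hiF, ?_⟩
      by_cases h2 : 3 ≤ 2 * i - i % 2 - A ∧ 2 * i - i % 2 - A ≤ 2 * N.card + 3
      · exact .inl h2
      · obtain ⟨u, hu⟩ : N.Nonempty := card_pos.1 (by omega)
        exact .inr ⟨u, hu, by have := hodd u hu; omega⟩
  · obtain ⟨i, hi1, hi2, hiF⟩ := exists_good_notMem (N.image w) N.card card_image_le
      (if (A + 3) % 4 = 0 then (A + 3) / 2 else if (A + 3) % 4 = 1 then (A + 4) / 2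
        else 2 * ((A + 3) / 4) + 2)
    obtain ⟨j, T, hj, hT1, hT5, hjT⟩ : ∃ (j : ℕ) (T : ℤ), j ≤ N.card ∧ 1 ≤ T ∧ T ≤ 5 ∧
        A + 2 * j + T = 2 * i - i % 2 := by
      have h1 : 3 ≤ 2 * i - i % 2 - A ∧ 2 * i - i % 2 - A ≤ 2 * N.card + 5 := by
        split_ifs at hi1 hi2 <;> omega
      by_cases h2 : 2 * i - i % 2 - A ≤ 2 * N.card + 3
      · refine ⟨((2 * i - i % 2 - A - 3) / 2).toNat,
          2 * i - i % 2 - A - 2 * ((2 * i - i % 2 - A - 3) / 2), ?_, ?_, ?_, ?_⟩ <;> omega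
      · exact ⟨N.card, 2 * i - i % 2 - A - 2 * N.card, by omega, by omega, by omega, by omega⟩
    obtain ⟨R, hR, rfl⟩ := exists_subset_card_eq hj
    exact ⟨R, hR, T, hT1, hT5, by rw [hjT]; omega, by rwa [hjT], fun h => absurd h h5⟩

theorem exists_isUpdate {N E : Finset V} (hNE : Disjoint N E) (hE : E.Nonempty) (x w : V → ℤ) :
    ∃ f, IsUpdate N E x w f := by
  obtain ⟨t, rfl⟩ | ⟨t, ht, g, hg, htg⟩ := hE.exists_eq_singleton_or_nontrivial
  · exact exists_isUpdate_of_one (disjoint_singleton_right.1 hNE) x w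
  · exact exists_isUpdate_of_two hNE x w ht hg htg

/-! ### The final step at a root -/

/-- The requirements on the new weights `f` of the edges at a vertex whose neighbours `N` have all
been processed. -/
structure IsFinalUpdate (N : Finset V) (x w f : V → ℤ) : Prop where
  back : ∀ u ∈ N, f u = x u ∨ f u = x u + 2
  sum_ne : ∀ u ∈ N, ∑ u ∈ N, f u ≠ w u + (f u - x u)
  not_mono : 6 ≤ N.card → ∃ u ∈ N, ∃ u' ∈ N, f u ≠ f u'

/-- With `j` edges raised the sum at the root is fixed. An unraised neighbour conflicts if `w u`
equals it, a raised one if `w u + 2` does; so the first kind must be raised and the second must not.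
-/
theorem exists_raise_sum_ne {N : Finset V} (x w : V → ℤ) {j : ℕ} (hj : j ≤ N.card)
    (h₁ : (N.filter fun u => w u = ∑ u ∈ N, x u + 2 * j).card ≤ j)
    (h₂ : (N.filter fun u => w u = ∑ u ∈ N, x u + 2 * j - 2).card ≤ N.card - j) :
    ∃ R ⊆ N, R.card = j ∧
      ∀ u ∈ N, ∑ u ∈ N, raise N R x 0 u ≠ w u + (raise N R x 0 u - x u) := by
  set B := N.filter fun u => w u = ∑ u ∈ N, x u + 2 * j - 2 with hB
  have hBN : B ⊆ N := filter_subset _ _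
  obtain ⟨R, hAR, hRB, rfl⟩ := exists_subsuperset_card_eq
    (show (N.filter fun u => w u = ∑ u ∈ N, x u + 2 * j) ⊆ N \ B by
      intro u hu
      simp only [hB, mem_sdiff, mem_filter] at hu ⊢
      exact ⟨hu.1, fun h => by omega⟩) h₁
    (by rw [card_sdiff_of_subset hBN]; omega)
  have hRN : R ⊆ N := hRB.trans sdiff_subset
  refine ⟨R, hRN, rfl, fun u hu => ?_⟩
  rw [sum_raise hRN, raise_of_mem hu]
  split_ifs with huR
  · have := (mem_sdiff.1 (hRB huR)).2
    simp only [hB, mem_filter, hu, true_and] at this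
    omega
  · have : ¬ w u = ∑ u ∈ N, x u + 2 * R.card := fun h => huR (hAR (mem_filter.2 ⟨hu, h⟩))
    omega

/-- The condition under which `j` of `d` edges can be raised without creating a conflict, where
`a` edges have to be raised and `b` edges must not be raised. -/
def Admissible (d j a b : ℕ) : Prop := j ≤ d ∧ a ≤ j ∧ b ≤ d - j

/-- One of `j = 0, 1, 2` works. The last is needed only if `n 1 = d` with `d` nonzero, and then `d ≠
1` gives `2 ≤ d`. -/
theorem exists_admissible {d : ℕ} (hd : d ≠ 1) (n : ℕ → ℕ)
    (hpar : n 2 = 0 ∨ (n 1 = 0 ∧ n 3 = 0)) (h0 : n 0 ≤ d) (htot : n 1 + n 2 + n 3 ≤ d) :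
    ∃ j, Admissible d j (n (j + 1)) (n j) := by
  unfold Admissible
  by_cases c0 : n 1 = 0
  · exact ⟨0, by omega, c0.le, h0⟩
  by_cases c1 : n 2 ≤ 1 ∧ n 1 ≤ d - 1
  · exact ⟨1, by omega, c1⟩
  · exact ⟨2, by omega, by norm_num only; omega⟩

theorem exists_two_admissible {d : ℕ} (hd : 6 ≤ d) (n : ℕ → ℕ)
    (hpar : (n 2 = 0 ∧ n 4 = 0 ∧ n 6 = 0) ∨ (n 1 = 0 ∧ n 3 = 0 ∧ n 5 = 0))
    (htot : n 1 + n 2 + n 3 + n 4 + n 5 + n 6 ≤ d) :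
    ∃ i j, i ≠ j ∧ 0 < i ∧ 0 < j ∧ i < d ∧ j < d ∧
      Admissible d i (n (i + 1)) (n i) ∧ Admissible d j (n (j + 1)) (n j) := by
  by_contra hne
  have h (i j : ℕ) (hij : 0 < i ∧ i < j ∧ j < d) :
      ¬ ((n (i + 1) ≤ i ∧ n i ≤ d - i) ∧ n (j + 1) ≤ j ∧ n j ≤ d - j) :=
    fun ⟨hi, hj⟩ => hne ⟨i, j, by omega, by omega, by omega, by omega, by omega,
      ⟨by omega, hi⟩, ⟨by omega, hj⟩⟩
  have h13 := h 1 3 (by omega)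
  have h14 := h 1 4 (by omega)
  have h15 := h 1 5 (by omega)
  have h23 := h 2 3 (by omega)
  have h24 := h 2 4 (by omega)
  have h25 := h 2 5 (by omega)
  have h34 := h 3 4 (by omega)
  simp only [Nat.reduceAdd] at h13 h14 h15 h23 h24 h25 h34
  obtain ⟨e2, e4, e6⟩ | ⟨e1, e3, e5⟩ := hpar
  · clear h15 h25 h34
    omega
  · omega

theorem exists_isFinalUpdate {N : Finset V} (hN : N.card ≠ 1) (x w : V → ℤ)
    (hw : ∀ u ∈ N, w u % 4 = 0 ∨ w u % 4 = 1) : ∃ f, IsFinalUpdate N x w f := by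
  set a := ∑ u ∈ N, x u with ha
  let n : ℕ → ℕ := fun k => (N.filter fun u => w u = a + 2 * k - 2).card
  have key : ∀ j, Admissible N.card j (n (j + 1)) (n j) → ∃ R ⊆ N, R.card = j ∧
      ∀ u ∈ N, ∑ u ∈ N, raise N R x 0 u ≠ w u + (raise N R x 0 u - x u) := by
    rintro j ⟨hj, h₁, h₂⟩
    refine exists_raise_sum_ne x w hj (le_of_eq_of_le ?_ h₁) h₂
    simp only [n]
    congr 2 with u
    push_cast
    rw [← ha, mul_add, mul_one, ← add_assoc, add_sub_cancel_right]
  have hzero : ∀ k : ℕ, (a + 2 * k - 2) % 4 ≠ 0 → (a + 2 * k - 2) % 4 ≠ 1 → n k = 0 := by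
    intro k h0 h1
    refine card_eq_zero.2 (filter_eq_empty_iff.2 fun u hu h => ?_)
    have := hw u hu
    omega
  -- The candidates `a + 2 * k - 2` alternate between allowed and forbidden residues mod 4.
  have hpar : (n 2 = 0 ∧ n 4 = 0 ∧ n 6 = 0) ∨ (n 1 = 0 ∧ n 3 = 0 ∧ n 5 = 0) := by
    by_cases h : a % 4 = 0 ∨ a % 4 = 1
    · left
      refine ⟨hzero _ ?_ ?_, hzero _ ?_ ?_, hzero _ ?_ ?_⟩ <;> omega
    · right
      refine ⟨hzero _ ?_ ?_, hzero _ ?_ ?_, hzero _ ?_ ?_⟩ <;> omega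
  have htot : n 0 + n 1 + n 2 + n 3 + n 4 + n 5 + n 6 ≤ N.card := by
    have h := card_le_card
      (s := (range 7).biUnion fun k : ℕ => N.filter fun u => w u = a + 2 * k - 2)
      (t := N) (biUnion_subset.2 fun _ _ => filter_subset _ _)
    rw [card_biUnion] at h
    · simpa [sum_range_succ, n] using h
    · intro i _ j _ hij
      exact disjoint_filter.2 fun u _ h1 h2 => hij (by omega)
  by_cases h6 : 6 ≤ N.card
  · obtain ⟨i, j, hij, hi0, hj0, hi, hj, hai, haj⟩ :=
      exists_two_admissible h6 n hpar (by omega)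
    obtain ⟨R, hR, rfl, hs⟩ := key i hai
    obtain ⟨R', hR', rfl, hs'⟩ := key j haj
    -- Two different raise counts cannot both give constant weights: the indicators of `R` and `R'`
    -- would differ by a constant, which is 0 because both sets are nonempty and proper, so `R =
    -- R'`.
    by_cases hm : ∃ u ∈ N, ∃ u' ∈ N, raise N R x 0 u ≠ raise N R x 0 u'
    · exact ⟨raise N R x 0, fun u hu => raise_eq_or hu, hs, fun _ => hm⟩
    refine ⟨raise N R' x 0, fun u hu => raise_eq_or hu, hs', fun _ => ?_⟩
    by_contra! hm'
    push Not at hm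
    obtain ⟨p, hp, hpR⟩ := exists_mem_notMem_of_card_lt_card hi
    obtain ⟨q, hq, hqR'⟩ := exists_mem_notMem_of_card_lt_card hj
    obtain ⟨p', hp'⟩ := card_pos.1 hi0
    obtain ⟨q', hq'⟩ := card_pos.1 hj0
    have diff : ∀ u ∈ N, ∀ v ∈ N, (if u ∈ R then (2 : ℤ) else 0) - (if u ∈ R' then 2 else 0) =
        (if v ∈ R then 2 else 0) - (if v ∈ R' then 2 else 0) := by
      intro u hu v hv
      have e1 := hm u hu v hv
      have e2 := hm' u hu v hv
      simp only [raise_of_mem hu, raise_of_mem hv] at e1 e2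
      omega
    refine hij (congrArg card (Finset.ext fun u => ?_))
    by_cases hu : u ∈ N
    · have d1 := diff u hu p hp
      have d2 := diff u hu q hq
      have d3 := diff u hu p' (hR hp')
      have d4 := diff u hu q' (hR' hq')
      simp only [hpR, hqR', hp', hq', if_true, if_false] at d1 d2 d3 d4
      by_cases h1 : u ∈ R <;> by_cases h2 : u ∈ R' <;>
        simp only [h1, h2, if_true, if_false] at d1 d2 d3 d4 ⊢ <;>
        split_ifs at d1 d2 d3 d4 <;> omega
    · exact iff_of_false (fun h => hu (hR h)) fun h => hu (hR' h)
  · obtain ⟨j, hj⟩ := exists_admissible hN n (by omega) (by omega) (by omega)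
    obtain ⟨R, -, -, hs⟩ := key j hj
    exact ⟨raise N R x 0, fun u hu => raise_eq_or hu, hs, fun h => absurd h h6⟩

end Selection

namespace SimpleGraph

/-! ### Roots of components -/

section Root

variable {V : Type*} {G : SimpleGraph V}

theorem nonempty_iso_of_adj_unique {C : G.ConnectedComponent} {a b : V} (ha : a ∈ C.supp)
    (hab : G.Adj a b) (hau : ∀ c, G.Adj a c → c = b) (hbu : ∀ c, G.Adj b c → c = a) :
    Nonempty (C.toSimpleGraph ≃g completeGraph (Fin 2)) := by
  have hsub : ∀ v ∈ C.supp, v = a ∨ v = b := by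
    intro v hv
    have hr := (reachable_iff_reflTransGen a v).1 (C.reachable_of_mem_supp ha hv)
    induction hr with
    | refl => exact .inl rfl
    | tail h h' ih =>
      rcases ih (C.mem_supp_of_adj_mem_supp hv h'.symm) with rfl | rfl
      · exact .inr (hau _ h')
      · exact .inl (hbu _ h')
  have hsupp : C.supp = {a, b} := by
    refine Set.Subset.antisymm hsub ?_
    rintro v (rfl | rfl)
    · exact ha
    · exact C.mem_supp_of_adj_mem_supp ha hab
  have hcard : Nat.card C.supp = 2 := by
    rw [Nat.card_coe_set_eq, hsupp, Set.ncard_pair hab.ne]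
  have : Finite C.supp := Nat.finite_of_card_ne_zero (by omega)
  let e : C.supp ≃ Fin 2 := Finite.equivFinOfCardEq hcard
  refine ⟨⟨e, fun {x y} => ?_⟩⟩
  change e x ≠ e y ↔ G.Adj x y
  rw [e.injective.ne_iff]
  refine ⟨fun hxy => ?_, fun hxy h => hxy.ne (congrArg _ h)⟩
  have hxy' : (x : V) ≠ y := fun h => hxy (Subtype.ext h)
  rcases hsub x x.2 with hx | hx <;> rcases hsub y y.2 with hy | hy <;> rw [hx, hy] at hxy' ⊢
  · exact absurd rfl hxy'
  · exact hab
  · exact hab.symm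
  · exact absurd rfl hxy'

theorem IsNice.exists_degree_ne_one [G.LocallyFinite] (hG : G.IsNice) (C : G.ConnectedComponent) :
    ∃ v ∈ C.supp, G.degree v ≠ 1 := by
  by_contra! h
  obtain ⟨a, ha⟩ := C.nonempty_supp
  obtain ⟨b, hab, hau⟩ := degree_eq_one_iff_existsUnique_adj.1 (h a ha)
  obtain ⟨c, -, hbu⟩ := degree_eq_one_iff_existsUnique_adj.1
    (h b (C.mem_supp_of_adj_mem_supp ha hab))
  have hc := hbu a hab.symm
  obtain ⟨e⟩ := nonempty_iso_of_adj_unique ha hab hau fun d hd => (hbu d hd).trans hc.symm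
  exact (hG C).false e

theorem Reachable.exists_adj_dist_lt {v t : V} (h : G.Reachable v t) (hne : v ≠ t) :
    ∃ u, G.Adj v u ∧ G.dist u t < G.dist v t := by
  obtain ⟨p, hp⟩ := h.exists_walk_length_eq_dist
  cases p with
  | nil => exact absurd rfl hne
  | cons hvu q =>
    rw [Walk.length_cons] at hp
    exact ⟨_, hvu, by have := dist_le q; omega⟩

/-- The map `ρ` selects a vertex of degree other than one in each component, and `D` decreases along
some edge at each vertex that is not selected. -/
structure IsRootMap (G : SimpleGraph V) [G.LocallyFinite] (ρ : V → V) (D : V → ℕ) : Prop where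
  eq_of_adj : ∀ u v, G.Adj u v → ρ u = ρ v
  idem : ∀ v, ρ (ρ v) = ρ v
  degree_ne_one : ∀ v, ρ v = v → G.degree v ≠ 1
  exists_adj_lt : ∀ v, ρ v ≠ v → ∃ u, G.Adj v u ∧ D u < D v

theorem IsNice.exists_isRootMap [G.LocallyFinite] (hG : G.IsNice) : ∃ ρ D, IsRootMap G ρ D := by
  choose r hr hdeg using hG.exists_degree_ne_one
  have hr' : ∀ C, G.connectedComponentMk (r C) = C := hr
  refine ⟨fun v => r (G.connectedComponentMk v),
    fun v => G.dist v (r (G.connectedComponentMk v)), fun u v h => ?_, fun v => ?_, fun v h => ?_,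
    fun v h => ?_⟩
  · exact congrArg r (ConnectedComponent.sound h.reachable)
  · simp only [hr']
  · rw [← h]
    exact hdeg _
  · have hreach : G.Reachable v (r (G.connectedComponentMk v)) :=
      ConnectedComponent.exact (hr' _).symm
    obtain ⟨u, hvu, hlt⟩ := hreach.exists_adj_dist_lt (Ne.symm h)
    refine ⟨u, hvu, ?_⟩
    rwa [show G.connectedComponentMk u = G.connectedComponentMk v from
      (ConnectedComponent.sound hvu.reachable).symm]

end Root

/-! ### Running the procedure on the graph -/

section UpdateAt

variable {V : Type*} [DecidableEq V]

/-- Replace the weights of the edges at `v` by `f`. -/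
def updateAt (v : V) (f : V → ℤ) (ω : V → V → ℤ) (a b : V) : ℤ :=
  if a = v then f b else if b = v then f a else ω a b

theorem updateAt_left (v : V) (f : V → ℤ) (ω : V → V → ℤ) (b : V) :
    updateAt v f ω v b = f b := if_pos rfl

theorem updateAt_right {v a : V} (h : a ≠ v) (f : V → ℤ) (ω : V → V → ℤ) :
    updateAt v f ω a v = f a := by simp [updateAt, h]

theorem updateAt_of_ne {v a b : V} (ha : a ≠ v) (hb : b ≠ v) (f : V → ℤ) (ω : V → V → ℤ) :
    updateAt v f ω a b = ω a b := by simp [updateAt, ha, hb]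

end UpdateAt

section Weights

variable {V : Type*} [Fintype V] (G : SimpleGraph V) [DecidableRel G.Adj]

/-- The sum of the weights at `v`, for a weighting given as a function on pairs of vertices. -/
def vertexSum (ω : V → V → ℤ) (v : V) : ℤ := ∑ u ∈ G.neighborFinset v, ω v u

variable {G}

theorem vertexSum_congr {ω ω' : V → V → ℤ} {u : V} (h : ∀ z, G.Adj u z → ω' u z = ω u z) :
    G.vertexSum ω' u = G.vertexSum ω u :=
  sum_congr rfl fun z hz => h z ((mem_neighborFinset _ _ _).1 hz)

theorem cast_weightSum {ω : V → V → ℤ} (hsymm : ∀ u v, ω u v = ω v u)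
    (hpos : ∀ u v, G.Adj u v → 1 ≤ ω u v ∧ ω u v ≤ 7) (v : V) :
    (G.weightSum (fun e => (Sym2.lift ⟨ω, hsymm⟩ (e : Sym2 V)).toNat) v : ℤ) =
      G.vertexSum ω v := by
  unfold weightSum vertexSum
  rw [Nat.cast_sum]
  refine sum_nbij Subtype.val (fun u _ => (mem_neighborFinset _ _ _).2 u.2)
    Subtype.val_injective.injOn (fun u hu => ?_) fun u _ => ?_
  · exact ⟨⟨u, (mem_neighborFinset _ _ _).1 hu⟩, mem_coe.2 (mem_univ _), rfl⟩
  · have := hpos v u u.2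
    simp only [Sym2.lift_mk]
    omega

variable [DecidableEq V]

theorem vertexSum_of_forall_ne {ω ω' : V → V → ℤ} {u v : V} (huv : G.Adj u v)
    (h : ∀ z, G.Adj u z → z ≠ v → ω' u z = ω u z) :
    G.vertexSum ω' u = G.vertexSum ω u + (ω' u v - ω u v) := by
  have hv : v ∈ G.neighborFinset u := (mem_neighborFinset _ _ _).2 huv
  unfold vertexSum
  rw [← sum_erase_add _ _ hv, ← sum_erase_add (G.neighborFinset u) (ω u) hv,
    sum_congr rfl fun z hz => h z ((mem_neighborFinset _ _ _).1 (mem_of_mem_erase hz))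
      (ne_of_mem_erase hz)]
  ring

/-- The invariant of the weighting procedure after the vertices in `P` have been processed: `w v` is
the smaller of the two sums that are reserved for `v`. -/
structure Invariant (G : SimpleGraph V) [DecidableRel G.Adj] (P : Finset V) (ω : V → V → ℤ)
    (w : V → ℤ) : Prop where
  symm : ∀ u v, ω u v = ω v u
  mem_Icc : ∀ v ∈ P, ∀ u, G.Adj v u → 1 ≤ ω v u ∧ ω v u ≤ 7
  mod : ∀ v ∈ P, w v % 4 = 0 ∨ w v % 4 = 1
  sum : ∀ v ∈ P, G.vertexSum ω v = w v ∨ G.vertexSum ω v = w v + 2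
  ne : ∀ v ∈ P, ∀ u ∈ P, G.Adj v u → w v ≠ w u
  forward : ∀ v ∈ P, ∀ u ∉ P, G.Adj v u →
    1 ≤ ω v u - (G.vertexSum ω v - w v) ∧ ω v u - (G.vertexSum ω v - w v) ≤ 5
  forward_strong : ∀ v ∈ P, ∀ u ∉ P, ∀ u' ∉ P, G.Adj v u → G.Adj v u' → u ≠ u' →
    3 ≤ ω v u ∧ ω v u ≤ 5
  not_mono : ∀ v ∈ P, 6 ≤ G.degree v → ∃ u u', G.Adj v u ∧ G.Adj v u' ∧ ω v u ≠ ω v u' ∧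
    (ω v u % 2 ≠ ω v u' % 2 ∨ (u ∈ P ∧ u' ∈ P))

/-- The new vertex reserves its current sum as the lower one, and each processed neighbour stays in
its reserved pair. -/
theorem Invariant.insert {P : Finset V} {ω : V → V → ℤ} {w : V → ℤ} (h : Invariant G P ω w)
    {v : V} (hv : v ∉ P) (hE : ∃ u ∉ P, G.Adj v u) :
    ∃ ω' w', Invariant G (insert v P) ω' w' := by
  let x : V → ℤ := fun u => ω u v - (G.vertexSum ω u - w u)
  set N := (G.neighborFinset v).filter (· ∈ P) with hN
  set E := (G.neighborFinset v).filter (· ∉ P) with hE'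
  have hmN : ∀ {u}, u ∈ N ↔ G.Adj v u ∧ u ∈ P := by simp [hN]
  have hmE : ∀ {u}, u ∈ E ↔ G.Adj v u ∧ u ∉ P := by simp [hE']
  have hNE : N ∪ E = G.neighborFinset v := filter_union_filter_not_eq _ _
  obtain ⟨u₀, hu₀, hvu₀⟩ := hE
  obtain ⟨f, hf⟩ := exists_isUpdate (disjoint_filter_filter_not _ _ _ : Disjoint N E)
    ⟨u₀, hmE.2 ⟨hvu₀, hu₀⟩⟩ x w
  have hback := fun u (huv : G.Adj v u) (hu : u ∈ P) => hf.back u (hmN.2 ⟨huv, hu⟩)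
  have hPv : ∀ {u}, u ∈ P → u ≠ v := fun hu h => hv (h ▸ hu)
  have hsv : G.vertexSum (updateAt v f ω) v = ∑ u ∈ N ∪ E, f u := by
    rw [hNE]
    exact sum_congr rfl fun u _ => updateAt_left v f ω u
  have hadj : ∀ u, G.Adj v u → u ∈ P →
      G.vertexSum (updateAt v f ω) u = w u + (f u - x u) := by
    intro u huv hu
    rw [vertexSum_of_forall_ne huv.symm fun z _ hz => updateAt_of_ne (hPv hu) hz f ω,
      updateAt_right (hPv hu)]
    simp only [x]
    ring
  have hnadj : ∀ u, ¬ G.Adj v u → u ≠ v →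
      G.vertexSum (updateAt v f ω) u = G.vertexSum ω u := by
    intro u huv hu
    refine vertexSum_congr fun z hz => updateAt_of_ne hu ?_ f ω
    rintro rfl
    exact huv hz.symm
  have hsum : ∀ u ∈ P, G.vertexSum (updateAt v f ω) u = w u ∨
      G.vertexSum (updateAt v f ω) u = w u + 2 := by
    intro u hu
    by_cases huv : G.Adj v u
    · rw [hadj u huv hu]
      have := hback u huv hu
      omega
    · rw [hnadj u huv (hPv hu)]
      exact h.sum u hu
  have hx : ∀ u, G.Adj v u → u ∈ P → 1 ≤ x u ∧ x u ≤ 5 :=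
    fun u huv hu => h.forward u hu v hv huv.symm
  have hw : ∀ u ∈ P, Function.update w v (∑ u ∈ N ∪ E, f u) u = w u :=
    fun u hu => Function.update_of_ne (hPv hu) _ _
  have hwv : Function.update w v (∑ u ∈ N ∪ E, f u) v = ∑ u ∈ N ∪ E, f u :=
    Function.update_self _ _ _
  refine ⟨updateAt v f ω, Function.update w v (∑ u ∈ N ∪ E, f u), ?_, ?_, ?_, ?_, ?_, ?_, ?_, ?_⟩
  · intro a b
    unfold updateAt
    split_ifs with h1 h2
    · rw [h1, h2]
    · rfl
    · rfl
    · exact h.symm a b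
  · have hfv : ∀ u, G.Adj v u → 1 ≤ f u ∧ f u ≤ 7 := by
      intro u huv
      by_cases hu : u ∈ P
      · have := hback u huv hu
        have := hx u huv hu
        omega
      · have := hf.forward u (hmE.2 ⟨huv, hu⟩)
        omega
    intro z hz u hzu
    rcases mem_insert.1 hz with rfl | hz
    · rw [updateAt_left]
      exact hfv u hzu
    · by_cases huv : u = v
      · rw [huv, updateAt_right (hPv hz)]
        exact hfv z (huv ▸ hzu.symm)
      · rw [updateAt_of_ne (hPv hz) huv]
        exact h.mem_Icc z hz u hzu
  · intro z hz
    rcases mem_insert.1 hz with rfl | hz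
    · rw [hwv]
      exact hf.sum_mod
    · rw [hw z hz]
      exact h.mod z hz
  · intro z hz
    rcases mem_insert.1 hz with rfl | hz
    · rw [hwv]
      exact .inl hsv
    · rw [hw z hz]
      exact hsum z hz
  · intro z hz u hu hzu
    rw [mem_insert] at hz hu
    rcases hz with rfl | hz <;> rcases hu with rfl | hu
    · exact absurd hzu G.irrefl
    · rw [hwv, hw u hu]
      exact (hf.sum_ne u (hmN.2 ⟨hzu, hu⟩)).symm
    · rw [hwv, hw z hz]
      exact hf.sum_ne z (hmN.2 ⟨hzu.symm, hz⟩)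
    · rw [hw z hz, hw u hu]
      exact h.ne z hz u hu hzu
  · intro z hz u hu hzu
    rw [mem_insert, not_or] at hu
    rcases mem_insert.1 hz with rfl | hz
    · rw [hwv, hsv, updateAt_left, sub_self, sub_zero]
      exact hf.forward u (hmE.2 ⟨hzu, hu.2⟩)
    · rw [hw z hz, updateAt_of_ne (hPv hz) hu.1]
      by_cases hzv : G.Adj v z
      -- Here `z` had two unprocessed neighbours `u` and `v`, so its weight at `u` is in 3..5 and
      -- can absorb a shift of 0 or 2.
      · have h1 := hsum z hz
        have h2 := h.forward_strong z hz u hu.2 v hv hzu hzv.symm hu.1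
        omega
      · rw [hnadj z hzv (hPv hz)]
        exact h.forward z hz u hu.2 hzu
  · intro z hz u hu u' hu' hzu hzu' huu'
    rw [mem_insert, not_or] at hu hu'
    rcases mem_insert.1 hz with rfl | hz
    · rw [updateAt_left]
      exact hf.forward_strong u (hmE.2 ⟨hzu, hu.2⟩) u' (hmE.2 ⟨hzu', hu'.2⟩) huu'
    · rw [updateAt_of_ne (hPv hz) hu.1]
      exact h.forward_strong z hz u hu.2 u' hu'.2 hzu hzu' huu'
  · intro z hz h6
    rcases mem_insert.1 hz with rfl | hz
    · simp only [updateAt_left]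
      obtain ⟨u, hu, u', hu', hne, hor⟩ := hf.not_mono (by rwa [hNE, card_neighborFinset_eq_degree])
      rw [hNE, mem_neighborFinset] at hu hu'
      exact ⟨u, u', hu, hu', hne, hor.imp_right fun h =>
        ⟨mem_insert_of_mem (hmN.1 h.1).2, mem_insert_of_mem (hmN.1 h.2).2⟩⟩
    · have hpar : ∀ u, G.Adj z u → updateAt v f ω z u % 2 = ω z u % 2 := by
        intro u hzu
        by_cases huv : u = v
        · have h1 := hback z (huv ▸ hzu.symm) hz
          rw [huv, updateAt_right (hPv hz)]
          have h2 := h.sum z hz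
          simp only [x] at h1
          omega
        · rw [updateAt_of_ne (hPv hz) huv]
      obtain ⟨u, u', hu, hu', hne, hor⟩ := h.not_mono z hz h6
      refine ⟨u, u', hu, hu', ?_⟩
      rcases hor with hor | ⟨huP, huP'⟩
      · have h1 := hpar u hu
        have h2 := hpar u' hu'
        exact ⟨fun h => by rw [h] at h1; omega, .inl (by omega)⟩
      · rw [updateAt_of_ne (hPv hz) (hPv huP), updateAt_of_ne (hPv hz) (hPv huP')]
        exact ⟨hne, .inr ⟨mem_insert_of_mem huP, mem_insert_of_mem huP'⟩⟩

theorem IsRootMap.exists_invariant {ρ : V → V} {D : V → ℕ} (h : IsRootMap G ρ D) :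
    ∃ ω w, Invariant G (univ.filter fun v => ρ v ≠ v) ω w := by
  suffices H : ∀ P : Finset V, (∀ v ∈ P, ρ v ≠ v) → ∃ ω w, Invariant G P ω w from
    H _ fun v hv => (mem_filter.1 hv).2
  intro P
  induction P using Finset.induction_on_min_value D with
  | empty => exact fun _ => ⟨0, 0, by constructor <;> simp⟩
  | insert v P hv hD ih =>
    intro hP
    obtain ⟨ω, w, hi⟩ := ih fun u hu => hP u (mem_insert_of_mem hu)
    -- The vertex `v` minimises `D` on the enlarged set, so a neighbour with smaller `D` is
    -- unprocessed.
    obtain ⟨u, hvu, hu⟩ := h.exists_adj_lt v (hP v (mem_insert_self v P))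
    exact hi.insert hv ⟨u, fun huP => (hD u huP).not_gt hu, hvu⟩

theorem IsRootMap.exists_weighting {ρ : V → V} {D : V → ℕ} (h : IsRootMap G ρ D) :
    ∃ ω : V → V → ℤ, (∀ u v, ω u v = ω v u) ∧ (∀ u v, G.Adj u v → 1 ≤ ω u v ∧ ω u v ≤ 7) ∧
      (∀ u v, G.Adj u v → G.vertexSum ω u ≠ G.vertexSum ω v) ∧
      ∀ v, 6 ≤ G.degree v → ∃ u u', G.Adj v u ∧ G.Adj v u' ∧ ω v u ≠ ω v u' := by
  obtain ⟨ω, w, hi⟩ := h.exists_invariant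
  have hmem : ∀ {v}, v ∈ univ.filter (fun v => ρ v ≠ v) ↔ ρ v ≠ v := by simp
  have hnm : ∀ {v}, v ∉ univ.filter (fun v => ρ v ≠ v) ↔ ρ v = v := by simp
  have hnr : ∀ {r u}, ρ r = r → G.Adj r u → ρ u ≠ u := fun hr hru hu =>
    hru.ne (hr.symm.trans ((h.eq_of_adj _ _ hru).trans hu))
  have huniq : ∀ {r r' u}, ρ r = r → ρ r' = r' → G.Adj u r → G.Adj u r' → r = r' :=
    fun hr hr' hur hur' => hr.symm.trans
      ((h.eq_of_adj _ _ hur).symm.trans ((h.eq_of_adj _ _ hur').trans hr'))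
  have hex : ∀ r, ∃ f, ρ r = r →
      IsFinalUpdate (G.neighborFinset r) (fun u => ω u r - (G.vertexSum ω u - w u)) w f := by
    intro r
    by_cases hr : ρ r = r
    · obtain ⟨f, hf⟩ := exists_isFinalUpdate (N := G.neighborFinset r)
        (by rw [card_neighborFinset_eq_degree]; exact h.degree_ne_one r hr)
        (fun u => ω u r - (G.vertexSum ω u - w u)) w
        fun u hu => hi.mod u (hmem.2 (hnr hr ((mem_neighborFinset _ _ _).1 hu)))
      exact ⟨f, fun _ => hf⟩
    · exact ⟨0, fun h => absurd h hr⟩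
  choose f hf using hex
  -- All roots are finished at once: no vertex is adjacent to two of them. Two roots are never
  -- adjacent, so the value 0 is irrelevant.
  let ω' : V → V → ℤ := fun a b => 
    if ρ a = a then if ρ b = b then 0 else f a b else if ρ b = b then f b a else ω a b
  have hl : ∀ {r u}, ρ r = r → ρ u ≠ u → ω' r u = f r u := fun hr hu => by
    simp only [ω', if_pos hr, if_neg hu]
  have hrt : ∀ {u r}, ρ u ≠ u → ρ r = r → ω' u r = f r u := fun hu hr => by
    simp only [ω', if_neg hu, if_pos hr]
  have hnn : ∀ {u v}, ρ u ≠ u → ρ v ≠ v → ω' u v = ω u v := fun hu hv => by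
    simp only [ω', if_neg hu, if_neg hv]
  have hback : ∀ {r u}, ρ r = r → G.Adj u r → f r u = ω u r - (G.vertexSum ω u - w u) ∨
      f r u = ω u r - (G.vertexSum ω u - w u) + 2 :=
    fun hr hur => (hf _ hr).back _ ((mem_neighborFinset _ _ _).2 hur.symm)
  have hsr : ∀ {r}, ρ r = r → G.vertexSum ω' r = ∑ u ∈ G.neighborFinset r, f r u :=
    fun hr => sum_congr rfl fun u hu => hl hr (hnr hr ((mem_neighborFinset _ _ _).1 hu))
  have hsu : ∀ {r u}, ρ r = r → G.Adj u r →
      G.vertexSum ω' u = w u + (f r u - (ω u r - (G.vertexSum ω u - w u))) := by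
    intro r u hr hur
    have hu := hnr hr hur.symm
    rw [vertexSum_of_forall_ne (ω := ω) hur fun z hz hzr =>
      hnn hu fun hz' => hzr (huniq hz' hr hz hur), hrt hu hr]
    ring
  have hsum : ∀ {u}, ρ u ≠ u → G.vertexSum ω' u = w u ∨ G.vertexSum ω' u = w u + 2 := by
    intro u hu
    by_cases hr : ∃ r, ρ r = r ∧ G.Adj u r
    · obtain ⟨r, hr, hur⟩ := hr
      rw [hsu hr hur]
      have := hback hr hur
      omega
    · push Not at hr
      rw [vertexSum_congr (ω := ω) fun z hz => hnn hu fun hz' => hr z hz' hz]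
      exact hi.sum u (hmem.2 hu)
  have hfr : ∀ {r u}, ρ r = r → G.Adj u r → 1 ≤ f r u ∧ f r u ≤ 7 := by
    intro r u hr hur
    have h1 := hback hr hur
    have h2 := hi.forward u (hmem.2 (hnr hr hur.symm)) r (hnm.2 hr) hur
    omega
  have hrn : ∀ {r u}, ρ r = r → G.Adj r u → G.vertexSum ω' r ≠ G.vertexSum ω' u := by
    intro r u hr hru
    rw [hsr hr, hsu hr hru.symm]
    exact (hf r hr).sum_ne u ((mem_neighborFinset _ _ _).2 hru)
  refine ⟨ω', fun u v => ?_, fun u v huv => ?_, fun u v huv => ?_, fun v h6 => ?_⟩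
  · by_cases hu : ρ u = u <;> by_cases hv : ρ v = v
    · simp only [ω', if_pos hu, if_pos hv]
    · rw [hl hu hv, hrt hv hu]
    · rw [hl hv hu, hrt hu hv]
    · rw [hnn hu hv, hnn hv hu, hi.symm]
  · by_cases hu : ρ u = u
    · rw [hl hu (hnr hu huv)]
      exact hfr hu huv.symm
    · by_cases hv : ρ v = v
      · rw [hrt hu hv]
        exact hfr hv huv
      · rw [hnn hu hv]
        exact hi.mem_Icc u (hmem.2 hu) v huv
  · by_cases hu : ρ u = u
    · exact hrn hu huv
    · by_cases hv : ρ v = v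
      · exact (hrn hv huv.symm).symm
      -- Different lower sums congruent to 0 or 1 mod 4 give disjoint reserved pairs.
      · have h1 := hsum hu
        have h2 := hsum hv
        have h3 := hi.mod u (hmem.2 hu)
        have h4 := hi.mod v (hmem.2 hv)
        have h5 := hi.ne u (hmem.2 hu) v (hmem.2 hv) huv
        omega
  · by_cases hv : ρ v = v
    · obtain ⟨u, hu, u', hu', hne⟩ :=
        (hf v hv).not_mono (by rwa [card_neighborFinset_eq_degree])
      rw [mem_neighborFinset] at hu hu'
      exact ⟨u, u', hu, hu', by rwa [hl hv (hnr hv hu), hl hv (hnr hv hu')]⟩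
    · obtain ⟨u, u', hu, hu', hne, hor⟩ := hi.not_mono v (hmem.2 hv) h6
      refine ⟨u, u', hu, hu', ?_⟩
      have hpar : ∀ z, G.Adj v z → ω' v z % 2 = ω v z % 2 := by
        intro z hz
        by_cases hz' : ρ z = z
        · rw [hrt hv hz']
          have h1 := hback hz' hz
          have h2 := hi.sum v (hmem.2 hv)
          omega
        · rw [hnn hv hz']
      rcases hor with hor | ⟨hu1, hu2⟩
      · have h1 := hpar u hu
        have h2 := hpar u' hu'
        intro h
        rw [h] at h1
        omega
      · rwa [hnn hv (hmem.1 hu1), hnn hv (hmem.1 hu2)]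

end Weights

end SimpleGraph

theorem mainTheorem2 {V : Type*} [Fintype V] (G : SimpleGraph V) [DecidableRel G.Adj]
    (hG : G.IsNice) :
    ∃ ω : G.edgeSet → ℕ,
      G.IsEdgeWeighting 7 ω ∧
      G.IsNeighbourSumDistinguishing ω ∧
      ∀ v : V, 6 ≤ G.degree v →
        ∃ e f : G.edgeSet, v ∈ (e : Sym2 V) ∧ v ∈ (f : Sym2 V) ∧ ω e ≠ ω f := by
  classical
  obtain ⟨ρ, D, hρ⟩ := hG.exists_isRootMap
  obtain ⟨ω, hsymm, hpos, hne, hmono⟩ := hρ.exists_weighting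
  refine ⟨fun e => (Sym2.lift ⟨ω, hsymm⟩ (e : Sym2 V)).toNat, ?_, fun u v huv h => ?_,
    fun v h6 => ?_⟩
  · rintro ⟨e, he⟩
    induction e with
    | h u v =>
      have := hpos u v he
      simp only [Sym2.lift_mk, mem_Icc]
      omega
  · refine hne u v huv ?_
    rw [← SimpleGraph.cast_weightSum hsymm hpos, ← SimpleGraph.cast_weightSum hsymm hpos, h]
  · obtain ⟨u, u', hu, hu', huu'⟩ := hmono v h6
    refine ⟨⟨s(v, u), hu⟩, ⟨s(v, u'), hu'⟩, Sym2.mem_mk_left _ _, Sym2.mem_mk_left _ _, ?_⟩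
    have h1 := hpos v u hu
    have h2 := hpos v u' hu'
    simp only [Sym2.lift_mk]
    omega
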